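/- Let $n\ge 0$ be an integer, let $q$ be a prime power, and let $\mathcal{Q}$ be a non-singular quadric of $\mathrm{PG}(2n+1,q)$, either hyperbolic ($\mathcal{Q}=\mathcal{Q}^+(2n+1,q)$, whose largest subspaces have projective dimension $n$) or elliptic ($\mathcal{Q}=\mathcal{Q}^-(2n+1,q)$, whose largest subspaces have projective dimension $n-1$). Let $\Sigma$ be the set of hyperplanes of $\mathrm{PG}(2n+1,q)$ that meet $\mathcal{Q}$ in a parabolic quadric, i.e. in a non-singular quadric of the hyperplane. Then: (0) $\Sigma$ is exactly the set of hyperplanes that meet $\mathcal{Q}$ in $|\mathcal{Q}(2n,q)|=\frac{q^{2n}-1}{q-1}$ points. (P1) Every point of $\mathrm{PG}(2n+1,q)$ is contained in $q^n(q^n-1)$ or $q^{2n}$ hyperplanes of $\Sigma$ if $\mathcal{Q}$ is hyperbolic, and in $q^n(q^n+1)$ or $q^{2n}$ hyperplanes of $\Sigma$ if $\mathcal{Q}$ is elliptic. (P2) Every subspace of $\mathrm{PG}(2n+1,q)$ of codimension 2 that is contained in a hyperplane of $\Sigma$ is contained in at least $q-1$ hyperplanes of $\Sigma$. Moreover, every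 subspace of codimension 2 is contained in exactly $0$, $q-1$, $q$ or $q+1$ hyperplanes of $\Sigma$. (For $n=0$, the hyperplanes are the points of the line, the subspace of codimension 2 is the empty one, and a hyperplane is in $\Sigma$ iff it is not a point of $\mathcal{Q}$.) -/

import Mathlib

open scoped LinearAlgebra.Projectivization

namespace PGQuadric

section

variable {F V : Type*} [Field F] [AddCommGroup V] [Module F V]

/-- The point set of the quadric `Q = 0` in the projective space of `V`. -/
def quadric (Q : QuadraticForm F V) : Set (ℙ F V) :=
  {x | ∀ v ∈ x.submodule, Q v = 0}

/-- The point set in which the projective subspace given by `W` meets the quadric `Q = 0`. -/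
def quadricSection (Q : QuadraticForm F V) (W : Submodule F V) : Set (ℙ F V) :=
  {x | x ∈ quadric Q ∧ x.submodule ≤ W}

/-- `k` is the Witt index of `Q`, i.e. the largest (vector space) dimension of a totally singular
subspace; the largest projective subspaces on the quadric have projective dimension `k - 1`. -/
def HasWittIndex (Q : QuadraticForm F V) (k : ℕ) : Prop :=
  IsGreatest {d : ℕ | ∃ W : Submodule F V, (∀ w ∈ W, Q w = 0) ∧ Module.finrank F W = d} k

/-- `Q = 0` is a non-singular hyperbolic quadric of projective dimension `2n + 1`. -/
structure IsHyperbolic (n : ℕ) (Q : QuadraticForm F V) : Prop where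
  finrank_eq : Module.finrank F V = 2 * n + 2
  nondegenerate : Q.Nondegenerate
  wittIndex : HasWittIndex Q (n + 1)

/-- `Q = 0` is a non-singular elliptic quadric of projective dimension `2n + 1`. -/
structure IsElliptic (n : ℕ) (Q : QuadraticForm F V) : Prop where
  finrank_eq : Module.finrank F V = 2 * n + 2
  nondegenerate : Q.Nondegenerate
  wittIndex : HasWittIndex Q n

/-- `Q = 0` is a non-singular (parabolic) quadric of projective dimension `2n`. In
characteristic 2 the polar form then has a one-dimensional kernel, on which `Q` does not vanish. -/
structure IsParabolic (n : ℕ) (Q : QuadraticForm F V) : Prop where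
  finrank_eq : Module.finrank F V = 2 * n + 1
  nondegenerate : Q.Nondegenerate

/-- The hyperplanes `H` that meet the quadric `Q = 0` in a parabolic quadric of `H`
(here `V` has dimension `2n + 2`). -/
def parabolicHyperplanes (n : ℕ) (Q : QuadraticForm F V) : Set (Submodule F V) :=
  {H | IsParabolic n (Q.comp H.subtype)}

/-- The number of members of a set `S` of subspaces that contain the subspace `W`. -/
noncomputable def numContaining (S : Set (Submodule F V)) (W : Submodule F V) : ℕ :=
  {H : Submodule F V | H ∈ S ∧ W ≤ H}.ncard

/-- Every point lies in `a` or `b` members of `S`. -/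
def CondP1 (S : Set (Submodule F V)) (a b : ℕ) : Prop :=
  ∀ x : ℙ F V, numContaining S x.submodule = a ∨ numContaining S x.submodule = b

/-- Every subspace of codimension 2 that is contained in a member of `S` is contained in at least
`q - 1` members of `S`, where `q` is the order of the field. -/
def CondP2 (S : Set (Submodule F V)) : Prop :=
  ∀ W : Submodule F V, Module.finrank F W + 2 = Module.finrank F V →
    (∃ H ∈ S, W ≤ H) → Nat.card F - 1 ≤ numContaining S W

/-- Every subspace of codimension 2 lies in `0`, `q - 1`, `q` or `q + 1` members of `S`. -/
def CodimTwoNumbers (S : Set (Submodule F V)) : Prop :=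
  ∀ W : Submodule F V, Module.finrank F W + 2 = Module.finrank F V →
    numContaining S W = 0 ∨ numContaining S W = Nat.card F - 1 ∨
      numContaining S W = Nat.card F ∨ numContaining S W = Nat.card F + 1

/-- The hyperplanes that meet the quadric `Q = 0` in exactly `(q ^ (2n) - 1) / (q - 1)` points,
the number of points of a parabolic quadric of projective dimension `2n`. -/
def hyperplanesWithParabolicCount (n : ℕ) (Q : QuadraticForm F V) : Set (Submodule F V) :=
  {H | Module.finrank F H + 1 = Module.finrank F V ∧
    (quadricSection Q H).ncard = (Nat.card F ^ (2 * n) - 1) / (Nat.card F - 1)}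

end

end PGQuadric

/-!
Let `B` be the polar form of `Q` and `q` the order of the field. In even dimension `B` is
non-degenerate, also in characteristic 2 (`ker_polarBilin_eq_bot`), so the hyperplanes are the
orthogonal complements `u^⊥` of the points, and `u^⊥` meets the quadric in a parabolic quadric
exactly when its pole `u` is off the quadric (`perp_mem_parabolicHyperplanes`). By duality the
hyperplanes of `Σ` through a subspace `W` correspond to the points of `W^⊥` off the quadric
(`numContaining_parabolicHyperplanes`), and everything reduces to counting zeros of `Q` on a
subspace.

The counting rests on one identity (`card_mul_ncard_zeros_add`). If `T ≤ U` is totally singular and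
`v` is a vector of `U` not orthogonal to `T`, then `Q (v + t) = Q v + B v t` is a nonconstant affine
function of `t ∈ T`. Hence exactly one in `q` of the vectors of `U` outside `T^⊥` is singular, and
only `U ⊓ T^⊥` remains to be understood. For a totally singular `T` that is maximal in `U`, the
singular vectors of `U ⊓ T^⊥` are those of `T`. With `U = V` this gives the number of singular
vectors in terms of the Witt index. With `U = u^⊥` and `Q u ≠ 0` it gives `q ^ (2n)`, since a form
in three variables over a finite field has a nontrivial zero, which forces `T` to have dimension
`n`. With `T` spanned by a singular `u` and `U = V` it gives the number of singular vectors of the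
tangent hyperplane `u^⊥`. Subspaces of codimension 2 correspond to lines, on which `Q` is a binary
form with 0, 1, 2 or `q + 1` zeros (`ncard_nonsingularPoints_of_finrank_two`).
-/

namespace PGQuadric

variable {F V : Type*} [Field F] [AddCommGroup V] [Module F V]

/-! ### Orthogonality and totally singular subspaces -/

/-- The orthogonal complement of `W` with respect to the polar form of `Q`. -/
abbrev perp (Q : QuadraticForm F V) (W : Submodule F V) : Submodule F V :=
  LinearMap.BilinForm.orthogonal Q.polarBilin W

lemma mem_perp {Q : QuadraticForm F V} {W : Submodule F V} {v : V} :
    v ∈ perp Q W ↔ ∀ w ∈ W, QuadraticMap.polar Q w v = 0 := Iff.rfl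

lemma mem_perp_span_singleton {Q : QuadraticForm F V} {u v : V} :
    v ∈ perp Q (F ∙ u) ↔ QuadraticMap.polar Q u v = 0 := by
  rw [mem_perp]
  refine ⟨fun h ↦ h u (Submodule.mem_span_singleton_self u), fun h w hw ↦ ?_⟩
  obtain ⟨c, rfl⟩ := Submodule.mem_span_singleton.mp hw
  rw [QuadraticMap.polar_smul_left, h, smul_zero]

lemma polarBilin_isRefl (Q : QuadraticForm F V) :
    LinearMap.BilinForm.IsRefl Q.polarBilin := fun x y h ↦ by
  rw [QuadraticMap.polarBilin_apply_apply] at h ⊢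
  rwa [QuadraticMap.polar_comm]

lemma polarBilin_nondegenerate {Q : QuadraticForm F V} (h : Q.polarBilin.ker = ⊥) :
    LinearMap.BilinForm.Nondegenerate Q.polarBilin := by
  rw [LinearMap.BilinForm.Nondegenerate,
    LinearMap.IsRefl.nondegenerate_iff_separatingLeft (polarBilin_isRefl Q),
    LinearMap.separatingLeft_iff_ker_eq_bot]
  exact h

lemma map_add_eq (Q : QuadraticForm F V) (x y : V) :
    Q (x + y) = Q x + Q y + QuadraticMap.polar Q x y := QuadraticMap.map_add Q x y

/-- `T` is totally singular, i.e. its projective subspace lies on the quadric `Q = 0`. -/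
def IsTotallySingular (Q : QuadraticForm F V) (T : Submodule F V) : Prop :=
  ∀ w ∈ T, Q w = 0

lemma isTotallySingular_span_singleton {Q : QuadraticForm F V} {u : V} (hu : Q u = 0) :
    IsTotallySingular Q (F ∙ u) := by
  intro w hw
  obtain ⟨c, rfl⟩ := Submodule.mem_span_singleton.mp hw
  rw [QuadraticMap.map_smul, hu, smul_zero]

lemma IsTotallySingular.le_perp {Q : QuadraticForm F V} {T : Submodule F V}
    (hT : IsTotallySingular Q T) : T ≤ perp Q T := fun v hv ↦ mem_perp.mpr fun w hw ↦ by
  rw [QuadraticMap.polar, hT _ (T.add_mem hw hv), hT _ hw, hT _ hv]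
  simp

lemma IsTotallySingular.sup_span_singleton {Q : QuadraticForm F V} {T : Submodule F V}
    (hT : IsTotallySingular Q T) {v : V} (hv : v ∈ perp Q T) (hQ : Q v = 0) :
    IsTotallySingular Q (T ⊔ F ∙ v) := by
  intro w hw
  obtain ⟨t, ht, s, hs, rfl⟩ := Submodule.mem_sup.mp hw
  obtain ⟨c, rfl⟩ := Submodule.mem_span_singleton.mp hs
  rw [map_add_eq, hT t ht, QuadraticMap.map_smul, hQ, QuadraticMap.polar_smul_right,
    mem_perp.mp hv t ht]
  simp

lemma lt_sup_span_singleton {T : Submodule F V} {v : V} (hv : v ∉ T) : T < T ⊔ F ∙ v :=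
  lt_of_le_of_ne le_sup_left fun h ↦
    hv (h ▸ Submodule.mem_sup_right (Submodule.mem_span_singleton_self v))

lemma HasWittIndex.exists_totallySingular [FiniteDimensional F V] {Q : QuadraticForm F V} {k : ℕ}
    (h : HasWittIndex Q k) : ∃ T : Submodule F V, IsTotallySingular Q T ∧
      Module.finrank F T = k ∧ ∀ v ∈ perp Q T, Q v = 0 → v ∈ T := by
  obtain ⟨T, hT, hk⟩ := h.1
  refine ⟨T, hT, hk, fun v hv hQ ↦ ?_⟩
  by_contra hvT
  have h1 := h.2 ⟨_, IsTotallySingular.sup_span_singleton hT hv hQ, rfl⟩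
  have h2 := Submodule.finrank_lt_finrank_of_lt (lt_sup_span_singleton hvT)
  lia

lemma exists_maximal_totallySingular [FiniteDimensional F V] (Q : QuadraticForm F V)
    (U : Submodule F V) : ∃ T : Submodule F V, T ≤ U ∧ IsTotallySingular Q T ∧
      ∀ v ∈ U ⊓ perp Q T, Q v = 0 → v ∈ T := by
  obtain ⟨T, ⟨hTU, hT⟩, hmax⟩ := wellFounded_gt.has_min
    {T : Submodule F V | T ≤ U ∧ IsTotallySingular Q T}
    ⟨⊥, bot_le, fun w hw ↦ by rw [(Submodule.mem_bot F).mp hw, QuadraticMap.map_zero]⟩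
  refine ⟨T, hTU, hT, fun v hv hQ ↦ ?_⟩
  by_contra hvT
  exact hmax _ ⟨sup_le hTU ((Submodule.span_singleton_le_iff_mem _ _).mpr hv.1),
    hT.sup_span_singleton hv.2 hQ⟩ (lt_sup_span_singleton hvT)

/-- A totally singular subspace meets the kernel of the polar form of a non-degenerate `Q`
trivially, also in characteristic 2 where that kernel may be nonzero. -/
lemma IsTotallySingular.finrank_add_finrank_perp [FiniteDimensional F V] {Q : QuadraticForm F V}
    (hQ : Q.radical = ⊥) {T : Submodule F V} (hT : IsTotallySingular Q T) :
    Module.finrank F T + Module.finrank F (perp Q T) = Module.finrank F V := by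
  rw [LinearMap.BilinForm.finrank_add_finrank_orthogonal' T]
  have : T ⊓ LinearMap.ker Q.polarBilin = ⊥ := by
    rw [eq_bot_iff, ← hQ]
    exact fun v hv ↦ ⟨hT v hv.1, hv.2⟩
  rw [this, finrank_bot, add_zero]

lemma exists_mem_notMem_of_finrank_lt [FiniteDimensional F V] {S U : Submodule F V}
    (h : Module.finrank F S < Module.finrank F U) : ∃ v ∈ U, v ∉ S := by
  by_contra! hc
  exact absurd (Submodule.finrank_mono hc) (by lia)

lemma finrank_le_inf_perp_add_one [FiniteDimensional F V] (Q : QuadraticForm F V)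
    (U : Submodule F V) (u : V) :
    Module.finrank F U ≤ Module.finrank F (U ⊓ perp Q (F ∙ u) : Submodule F V) + 1 := by
  have h1 := LinearMap.BilinForm.finrank_add_finrank_orthogonal' (B := Q.polarBilin) (F ∙ u)
  have h2 := Submodule.finrank_sup_add_finrank_inf_eq U (perp Q (F ∙ u))
  have h3 := Submodule.finrank_le (U ⊔ perp Q (F ∙ u))
  have h4 : Module.finrank F (F ∙ u) ≤ 1 := by
    simpa using finrank_span_le_card (R := F) ({u} : Set V)
  change _ + Module.finrank F (perp Q (F ∙ u)) = _ at h1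
  lia

/-! ### Zeros of quadratic forms over finite fields -/

section

variable [Finite F]

lemma exists_add_sq_mul_eq_zero (h2 : (2 : F) = 0) (a : F) {b : F} (hb : b ≠ 0) :
    ∃ c : F, a + c * c * b = 0 := by
  have : ringChar F = 2 := CharP.ringChar_of_prime_eq_zero Nat.prime_two (by exact_mod_cast h2)
  obtain ⟨c, hc⟩ := FiniteField.isSquare_of_char_two this (-a / b)
  exact ⟨c, by rw [← hc]; field_simp; ring⟩

lemma exists_sq_mul_add_sq_mul_add_eq_zero (h2 : (2 : F) ≠ 0) {a b : F} (ha : a ≠ 0) (hb : b ≠ 0)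
    (d : F) : ∃ x y : F, x * x * a + y * y * b + d = 0 := by
  have := Fintype.ofFinite F
  have hodd : Fintype.card F % 2 = 1 := FiniteField.odd_card_of_char_ne_two fun h ↦
    h2 (by exact_mod_cast (ringChar.spec F 2).mpr h.dvd)
  obtain ⟨x, y, h⟩ := FiniteField.exists_root_sum_quadratic
    (f := .C a * .X ^ 2 + .C 0 * .X + .C 0) (g := .C b * .X ^ 2 + .C 0 * .X + .C d)
    (Polynomial.degree_quadratic ha) (Polynomial.degree_quadratic hb) hodd
  refine ⟨x, y, ?_⟩
  simp at h
  linear_combination h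

/-- A quadratic form over a finite field has a nontrivial zero on every subspace of dimension at
least 3 (the quadratic case of the Chevalley–Warning theorem). -/
lemma exists_ne_zero_of_three_le_finrank [FiniteDimensional F V] (Q : QuadraticForm F V)
    {U : Submodule F V} (hU : 3 ≤ Module.finrank F U) : ∃ v ∈ U, v ≠ 0 ∧ Q v = 0 := by
  obtain ⟨v, hvU, hv⟩ := exists_mem_notMem_of_finrank_lt (S := ⊥) (U := U)
    (by rw [finrank_bot]; lia)
  rw [Submodule.mem_bot] at hv
  by_cases hQv : Q v = 0
  · exact ⟨v, hvU, hv, hQv⟩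
  have h1 := finrank_le_inf_perp_add_one Q U v
  obtain ⟨w, ⟨hwU, hwv⟩, hw⟩ := exists_mem_notMem_of_finrank_lt (S := F ∙ v)
    (U := U ⊓ perp Q (F ∙ v)) (by rw [finrank_span_singleton hv]; lia)
  rw [SetLike.mem_coe, mem_perp_span_singleton] at hwv
  have hw0 : w ≠ 0 := fun h ↦ hw (h ▸ zero_mem _)
  by_cases hQw : Q w = 0
  · exact ⟨w, hwU, hw0, hQw⟩
  by_cases h2 : (2 : F) = 0
  · obtain ⟨c, hc⟩ := exists_add_sq_mul_eq_zero h2 (Q w) hQv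
    refine ⟨w + c • v, U.add_mem hwU (U.smul_mem c hvU), fun h ↦ hw ?_, ?_⟩
    · rw [eq_neg_of_add_eq_zero_left h]
      exact neg_mem (Submodule.smul_mem _ c (Submodule.mem_span_singleton_self v))
    · rw [map_add_eq, QuadraticMap.map_smul, QuadraticMap.polar_smul_right,
        QuadraticMap.polar_comm, hwv, smul_zero, add_zero, smul_eq_mul, hc]
  · have h3 := finrank_le_inf_perp_add_one Q (U ⊓ perp Q (F ∙ v)) w
    obtain ⟨x, ⟨⟨hxU, hxv⟩, hxw⟩, hx⟩ := exists_mem_notMem_of_finrank_lt (S := ⊥)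
      (U := U ⊓ perp Q (F ∙ v) ⊓ perp Q (F ∙ w)) (by rw [finrank_bot]; lia)
    rw [Submodule.mem_bot] at hx
    rw [SetLike.mem_coe, mem_perp_span_singleton] at hxv hxw
    obtain ⟨a, b, hab⟩ := exists_sq_mul_add_sq_mul_add_eq_zero h2 hQv hQw (Q x)
    by_cases hQx : Q x = 0
    · exact ⟨x, hxU, hx, hQx⟩
    refine ⟨a • v + b • w + x, U.add_mem (U.add_mem (U.smul_mem a hvU) (U.smul_mem b hwU)) hxU,
      fun h ↦ ?_, ?_⟩
    · -- Pairing the relation with `x` leaves `polar Q x x = 2 * Q x`.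
      have hp : QuadraticMap.polar Q (a • v + b • w + x) x = 2 • Q x := by
        simp [QuadraticMap.polar_add_left, QuadraticMap.polar_smul_left, hxv, hxw]
      rw [h, QuadraticMap.polar_zero_left, nsmul_eq_mul, Nat.cast_ofNat] at hp
      exact mul_ne_zero h2 hQx hp.symm
    · simp only [map_add_eq, QuadraticMap.map_smul, QuadraticMap.polar_add_left,
        QuadraticMap.polar_smul_left, QuadraticMap.polar_smul_right, hxv, hxw, hwv, smul_eq_mul,
        mul_zero, add_zero]
      exact hab

/-- In even dimension, the polar form of a nondegenerate quadratic form has trivial kernel. A kernel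
vector `r` would have `Q r ≠ 0`, which forces characteristic 2. For a totally singular `T` of
dimension equal to the Witt index `k`, the subspace `T ⊔ F ∙ r` of `T^⊥` has dimension `k + 1`; this
differs from `dim T^⊥ = 2n + 2 - k` by parity. Since every element of `F` is a square, adding a
multiple of `r` to a vector of `T^⊥` outside `T ⊔ F ∙ r` makes it singular, against the maximality
of `T`. -/
lemma ker_polarBilin_eq_bot [FiniteDimensional F V] {Q : QuadraticForm F V} {n k : ℕ}
    (hV : Module.finrank F V = 2 * n + 2) (hQ : Q.Nondegenerate) (hk : HasWittIndex Q k) :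
    Q.polarBilin.ker = ⊥ := by
  by_contra hne
  obtain ⟨r, hr, hr0⟩ := Submodule.exists_mem_ne_zero_of_ne_bot hne
  have hpr : ∀ v, QuadraticMap.polar Q r v = 0 := fun v ↦ LinearMap.congr_fun hr v
  have hQr : Q r ≠ 0 := fun h ↦ hr0 <| by
    have : r ∈ Q.radical := ⟨h, hr⟩
    rwa [hQ.radical_eq_bot, Submodule.mem_bot] at this
  have h2 : (2 : F) = 0 := by
    have h := hpr r
    rw [QuadraticMap.polar_self, nsmul_eq_mul, Nat.cast_ofNat] at h
    exact (mul_eq_zero.mp h).resolve_right hQr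
  obtain ⟨T, hT, hTk, hmax⟩ := hk.exists_totallySingular
  have hdim := hT.finrank_add_finrank_perp hQ.radical_eq_bot
  have hrT : r ∈ perp Q T := mem_perp.mpr fun w _ ↦ by rw [QuadraticMap.polar_comm, hpr]
  have hle : T ⊔ F ∙ r ≤ perp Q T :=
    sup_le hT.le_perp ((Submodule.span_singleton_le_iff_mem _ _).mpr hrT)
  have hlt := Submodule.finrank_lt_finrank_of_lt
    (lt_sup_span_singleton (fun h ↦ hQr (hT r h)) : T < T ⊔ F ∙ r)
  have hmono := Submodule.finrank_mono hle
  have hsup := Submodule.finrank_add_le_finrank_add_finrank T (F ∙ r)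
  rw [finrank_span_singleton hr0] at hsup
  obtain ⟨w, hwT, hw⟩ := exists_mem_notMem_of_finrank_lt (S := T ⊔ F ∙ r) (U := perp Q T)
    (by lia)
  obtain ⟨c, hc⟩ := exists_add_sq_mul_eq_zero h2 (Q w) hQr
  have hmem : w + c • r ∈ T := hmax _ (Submodule.add_mem _ hwT (Submodule.smul_mem _ c hrT)) <| by
    rw [map_add_eq, QuadraticMap.map_smul, QuadraticMap.polar_smul_right, QuadraticMap.polar_comm,
      hpr, smul_zero, add_zero, smul_eq_mul, hc]
  refine hw ?_
  rw [← add_sub_cancel_right w (c • r)]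
  exact Submodule.sub_mem _ (Submodule.mem_sup_left hmem)
    (Submodule.mem_sup_right (Submodule.smul_mem _ c (Submodule.mem_span_singleton_self r)))

end

/-! ### Counting zeros of a quadratic form on a subspace -/

/-- The singular vectors of `Q` in the subspace `U`, including the zero vector. -/
def zeros (Q : QuadraticForm F V) (U : Submodule F V) : Set V := {v | v ∈ U ∧ Q v = 0}

lemma ncard_zeros_eq_card {Q : QuadraticForm F V} {T P : Submodule F V} (hTP : T ≤ P)
    (hT : IsTotallySingular Q T) (h : ∀ v ∈ P, Q v = 0 → v ∈ T) :
    (zeros Q P).ncard = Nat.card T := by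
  rw [← SetLike.coe_sort_coe, Nat.card_coe_set_eq]
  congr 1
  ext v
  exact ⟨fun hv ↦ h v hv.1 hv.2, fun hv ↦ ⟨hTP hv, hT v hv⟩⟩

lemma card_eq_pow [FiniteDimensional F V] (U : Submodule F V) :
    Nat.card U = Nat.card F ^ Module.finrank F U := Module.natCard_eq_pow_finrank

section

variable [Finite F]

lemma card_mul_ncard_fiber {T : Type*} [AddCommGroup T] [Module F T] [Finite T] {φ : T →ₗ[F] F}
    (hφ : φ ≠ 0) (c : F) : Nat.card F * {t | φ t = c}.ncard = Nat.card T := by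
  classical
  have := Fintype.ofFinite F
  have := Fintype.ofFinite T
  have hs : ∀ d, d ∈ Set.range φ := LinearMap.surjective hφ
  have hcard := Finset.card_eq_sum_card_fiberwise (f := φ) (s := Finset.univ) (t := Finset.univ)
    (fun _ _ ↦ Finset.mem_coe.mpr (Finset.mem_univ _))
  rw [Finset.sum_congr rfl fun d _ ↦
    AddMonoidHom.card_fiber_eq_of_mem_range φ (hs d) (hs c)] at hcard
  rw [Nat.card_eq_fintype_card, Nat.card_eq_fintype_card, ← Finset.card_univ (α := T), hcard,
    Finset.sum_const, smul_eq_mul, Finset.card_univ, Set.ncard_eq_toFinset_card']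
  congr 2
  ext
  simp

/-- Translations by `T` equidistribute `Q` over the vectors outside the orthogonal complement of a
totally singular subspace `T`, so that there exactly one vector in `|F|` is singular. -/
lemma card_mul_ncard_zeros_diff [Finite V] {Q : QuadraticForm F V} {T U : Submodule F V}
    (hTU : T ≤ U) (hT : IsTotallySingular Q T) :
    Nat.card F * {v | (v ∈ U ∧ v ∉ perp Q T) ∧ Q v = 0}.ncard =
      {v | v ∈ U ∧ v ∉ perp Q T}.ncard := by
  classical
  have := Fintype.ofFinite V
  set A : Finset V := {v | v ∈ U ∧ v ∉ perp Q T} with hA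
  have hA' : {v | v ∈ U ∧ v ∉ perp Q T} = (A : Set V) := by ext; simp [hA]
  have hZ' : {v | (v ∈ U ∧ v ∉ perp Q T) ∧ Q v = 0} =
      (({v ∈ A | Q v = 0} : Finset V) : Set V) := by
    ext; simp [hA]
  rw [hA', hZ', Set.ncard_coe_finset, Set.ncard_coe_finset]
  -- Count the pairs `(t, v)` with `Q (t + v) = 0` in two ways.
  have hdc := Finset.sum_card_bipartiteAbove_eq_sum_card_bipartiteBelow
    (s := (Finset.univ : Finset T)) (t := A) (fun (t : T) v ↦ Q (t + v) = 0)
  have hleft : ∀ t : T, (A.bipartiteAbove (fun (t : T) v ↦ Q (t + v) = 0) t).card =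
      ({v ∈ A | Q v = 0} : Finset V).card := fun t ↦ by
    refine Finset.card_bij' (fun v _ ↦ t + v) (fun v _ ↦ -t + v) ?_ ?_ ?_ ?_
    · intro v hv
      simp only [Finset.mem_bipartiteAbove, hA, Finset.mem_filter, Finset.mem_univ, true_and]
        at hv ⊢
      rwa [Submodule.add_mem_iff_right _ (hTU t.2),
        Submodule.add_mem_iff_right _ (hT.le_perp t.2)]
    · intro v hv
      simp only [Finset.mem_bipartiteAbove, hA, Finset.mem_filter, Finset.mem_univ, true_and]
        at hv ⊢
      rwa [Submodule.add_mem_iff_right _ (neg_mem (hTU t.2)),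
        Submodule.add_mem_iff_right _ (neg_mem (hT.le_perp t.2)), add_neg_cancel_left]
    · intro v _; simp
    · intro v _; simp
  have hright : ∀ v ∈ A, Nat.card F * ((Finset.univ : Finset T).bipartiteBelow
      (fun (t : T) v ↦ Q (t + v) = 0) v).card = Nat.card T := fun v hv ↦ by
    simp only [hA, Finset.mem_filter, Finset.mem_univ, true_and] at hv
    have hφ : (Q.polarBilin v).comp T.subtype ≠ 0 := fun h0 ↦ hv.2 <| mem_perp.mpr fun w hw ↦ by
      rw [QuadraticMap.polar_comm]
      exact LinearMap.congr_fun h0 ⟨w, hw⟩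
    rw [← card_mul_ncard_fiber hφ (-Q v), Set.ncard_eq_toFinset_card']
    congr 2
    ext t
    simp [Finset.mem_bipartiteBelow, map_add_eq, hT t t.2,
      eq_neg_iff_add_eq_zero, add_comm]
  rw [Finset.sum_congr rfl fun t _ ↦ hleft t, Finset.sum_const, smul_eq_mul, Finset.card_univ,
    ← Nat.card_eq_fintype_card] at hdc
  have hsum : Nat.card F * (Nat.card T * ({v ∈ A | Q v = 0} : Finset V).card) =
      A.card * Nat.card T := by
    rw [hdc, Finset.mul_sum, Finset.sum_congr rfl hright, Finset.sum_const, smul_eq_mul]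
  refine Nat.eq_of_mul_eq_mul_left (Nat.card_pos (α := T)) ?_
  rw [mul_left_comm, hsum, mul_comm]

/-- Zeros of `Q` on `U` are counted by its zeros on the vectors of `U` orthogonal to a totally
singular subspace `T` of `U`. -/
lemma card_mul_ncard_zeros_add [Finite V] {Q : QuadraticForm F V} {T U : Submodule F V}
    (hTU : T ≤ U) (hT : IsTotallySingular Q T) :
    Nat.card F * (zeros Q U).ncard + Nat.card (U ⊓ perp Q T : Submodule F V) =
      Nat.card U + Nat.card F * (zeros Q (U ⊓ perp Q T)).ncard := by
  have h := card_mul_ncard_zeros_diff hTU hT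
  have h1 : (zeros Q U).ncard = (zeros Q (U ⊓ perp Q T)).ncard +
      {v | (v ∈ U ∧ v ∉ perp Q T) ∧ Q v = 0}.ncard := by
    rw [← Set.ncard_union_eq _ (Set.toFinite _) (Set.toFinite _)]
    · congr 1
      ext v
      simp only [zeros, Set.mem_union, Set.mem_ofPred_eq, Submodule.mem_inf]
      tauto
    · exact Set.disjoint_left.mpr fun v hv hv' ↦ hv'.1.2 hv.1.2
  have h2 : Nat.card U = Nat.card (U ⊓ perp Q T : Submodule F V) +
      {v | v ∈ U ∧ v ∉ perp Q T}.ncard := by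
    rw [← SetLike.coe_sort_coe, ← SetLike.coe_sort_coe, Nat.card_coe_set_eq, Nat.card_coe_set_eq,
      ← Set.ncard_union_eq _ (Set.toFinite _) (Set.toFinite _)]
    · congr 1
      ext v
      simp only [Set.mem_union, Set.mem_ofPred_eq, Submodule.mem_inf, SetLike.mem_coe]
      tauto
    · exact Set.disjoint_left.mpr fun v hv hv' ↦ hv'.2 hv.2
  rw [h1, h2, mul_add, h]
  ring

/-- The number of singular vectors in terms of the Witt index `k`. -/
lemma card_mul_ncard_zeros_top [FiniteDimensional F V] {Q : QuadraticForm F V} {m k : ℕ}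
    (hV : Module.finrank F V = k + m) (hQ : Q.Nondegenerate) (hk : HasWittIndex Q k) :
    Nat.card F * (zeros Q ⊤).ncard + Nat.card F ^ m =
      Nat.card F ^ (k + m) + Nat.card F ^ (k + 1) := by
  have := Module.finite_of_finite F (M := V)
  obtain ⟨T, hT, hTk, hmax⟩ := hk.exists_totallySingular
  have hdim := hT.finrank_add_finrank_perp hQ.radical_eq_bot
  have h := card_mul_ncard_zeros_add le_top hT
  rw [top_inf_eq, ncard_zeros_eq_card hT.le_perp hT hmax, card_eq_pow, card_eq_pow, card_eq_pow,
    finrank_top, hV, hTk, show Module.finrank F (perp Q T) = m by lia] at h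
  rw [h]
  ring

/-- A hyperplane `u^⊥` with `Q u ≠ 0` has as many singular vectors as a parabolic quadric, namely
`q ^ (2n)`: a maximal totally singular subspace of it has dimension `n`, because an anisotropic
form over a finite field lives in dimension at most 2. -/
lemma ncard_zeros_perp_of_ne_zero [FiniteDimensional F V] {Q : QuadraticForm F V} {n : ℕ}
    (hV : Module.finrank F V = 2 * n + 2) (hB : Q.polarBilin.ker = ⊥) {u : V} (hu : Q u ≠ 0) :
    (zeros Q (perp Q (F ∙ u))).ncard = Nat.card F ^ (2 * n) := by
  have := Module.finite_of_finite F (M := V)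
  have hnd := polarBilin_nondegenerate hB
  have hfr : ∀ W, Module.finrank F (perp Q W) = Module.finrank F V - Module.finrank F W :=
    LinearMap.BilinForm.finrank_orthogonal hnd
  have hu0 : u ≠ 0 := fun h ↦ hu (h ▸ Q.map_zero)
  obtain ⟨T, hTU, hT, hmax⟩ := exists_maximal_totallySingular Q (perp Q (F ∙ u))
  have huT : u ∉ T := fun h ↦ hu (hT u h)
  have hsup : Module.finrank F (T ⊔ F ∙ u : Submodule F V) = Module.finrank F T + 1 := by
    have h1 := Submodule.finrank_lt_finrank_of_lt (lt_sup_span_singleton huT)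
    have h2 := Submodule.finrank_add_le_finrank_add_finrank T (F ∙ u)
    rw [finrank_span_singleton hu0] at h2
    lia
  have hP : perp Q (F ∙ u) ⊓ perp Q T = perp Q (T ⊔ F ∙ u) := by
    refine le_antisymm (fun v hv ↦ mem_perp.mpr fun w hw ↦ ?_) (le_inf ?_ ?_)
    · obtain ⟨t, ht, s, hs, rfl⟩ := Submodule.mem_sup.mp hw
      rw [QuadraticMap.polar_add_left, mem_perp.mp hv.2 t ht, mem_perp.mp hv.1 s hs, add_zero]
    · exact LinearMap.BilinForm.orthogonal_le le_sup_right
    · exact LinearMap.BilinForm.orthogonal_le le_sup_left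
  have hle : T ≤ perp Q (F ∙ u) ⊓ perp Q T := le_inf hTU hT.le_perp
  have hPdim := hfr (T ⊔ F ∙ u)
  rw [← hP, hsup, hV] at hPdim
  have hTle := Submodule.finrank_mono hle
  have hTn : Module.finrank F T = n := by
    -- A complement of `T` in `P` is anisotropic.
    obtain ⟨C, hC⟩ := Submodule.exists_isCompl T
    set P := perp Q (F ∙ u) ⊓ perp Q T
    have hCP : Module.finrank F (P ⊓ C : Submodule F V) ≤ 2 := by
      by_contra! h
      obtain ⟨v, hvC, hv0, hQv⟩ := exists_ne_zero_of_three_le_finrank Q h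
      exact hv0 ((Submodule.disjoint_def.mp hC.disjoint) v (hmax v hvC.1 hQv) hvC.2)
    have h1 := Submodule.finrank_sup_add_finrank_inf_eq P C
    have h2 := Submodule.finrank_add_eq_of_isCompl hC
    have h3 := Submodule.finrank_le (P ⊔ C)
    lia
  have h := card_mul_ncard_zeros_add hTU hT
  rw [ncard_zeros_eq_card hle hT hmax, card_eq_pow, card_eq_pow, card_eq_pow, hPdim, hfr, hTn, hV,
    finrank_span_singleton hu0, show 2 * n + 2 - (n + 1) = n + 1 by lia,
    show 2 * n + 2 - 1 = 2 * n + 1 by lia, ← pow_succ', pow_succ' _ (2 * n),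
    Nat.add_right_cancel_iff] at h
  exact Nat.eq_of_mul_eq_mul_left Nat.card_pos h

/-- A tangent hyperplane `u^⊥`, where `Q u = 0`. -/
lemma ncard_zeros_perp_of_eq_zero [FiniteDimensional F V] {Q : QuadraticForm F V} {n : ℕ}
    (hV : Module.finrank F V = 2 * n + 2) (hB : Q.polarBilin.ker = ⊥) {u : V} (hu0 : u ≠ 0)
    (hu : Q u = 0) : Nat.card F * (zeros Q (perp Q (F ∙ u))).ncard + Nat.card F ^ (2 * n + 2) =
      Nat.card F * (zeros Q ⊤).ncard + Nat.card F ^ (2 * n + 1) := by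
  have := Module.finite_of_finite F (M := V)
  have hnd := polarBilin_nondegenerate hB
  have hfr : Module.finrank F (perp Q (F ∙ u)) = Module.finrank F V - Module.finrank F (F ∙ u) :=
    LinearMap.BilinForm.finrank_orthogonal hnd _
  have h := card_mul_ncard_zeros_add le_top (isTotallySingular_span_singleton hu)
  rw [top_inf_eq, card_eq_pow, card_eq_pow, finrank_top, hfr, hV, finrank_span_singleton hu0,
    show 2 * n + 2 - 1 = 2 * n + 1 by lia] at h
  rw [h, add_comm]

end

/-! ### Counting points of the projective space -/

/-- The points of the projective subspace of `U` that do not lie on the quadric `Q = 0`. -/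
def nonsingularPoints (Q : QuadraticForm F V) (U : Submodule F V) : Set (ℙ F V) :=
  {x | x ∉ quadric Q ∧ x.submodule ≤ U}

lemma mk_mem_quadric {Q : QuadraticForm F V} {v : V} (hv : v ≠ 0) :
    Projectivization.mk F v hv ∈ quadric Q ↔ Q v = 0 := by
  simp only [quadric, Set.mem_ofPred_eq, Projectivization.submodule_mk]
  exact ⟨fun h ↦ h v (Submodule.mem_span_singleton_self v),
    fun h ↦ isTotallySingular_span_singleton h⟩

lemma submodule_mk_le {U : Submodule F V} {v : V} (hv : v ≠ 0) :
    (Projectivization.mk F v hv).submodule ≤ U ↔ v ∈ U := by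
  rw [Projectivization.submodule_mk, Submodule.span_singleton_le_iff_mem]

lemma pred_card_mul_ncard (S : Set (ℙ F V)) :
    (Nat.card F - 1) * S.ncard = {v : V | ∃ hv : v ≠ 0, Projectivization.mk F v hv ∈ S}.ncard := by
  rw [← Nat.card_units, ← Nat.card_coe_set_eq, ← Nat.card_coe_set_eq, ← Nat.card_prod]
  have hne : ∀ (c : Fˣ) (x : ℙ F V), c • x.rep ≠ 0 := fun c x ↦
    (smul_ne_zero_iff_ne c).mpr x.rep_nonzero
  have hmk : ∀ (c : Fˣ) (x : ℙ F V), Projectivization.mk F (c • x.rep) (hne c x) = x :=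
    fun c x ↦ by
      conv_rhs => rw [← x.mk_rep]
      exact (Projectivization.mk_eq_mk_iff F _ _ _ _).mpr ⟨c, rfl⟩
  let f : Fˣ × S → {v : V | ∃ hv : v ≠ 0, Projectivization.mk F v hv ∈ S} := fun p ↦
    ⟨p.1 • p.2.1.rep, hne _ _, by rw [hmk]; exact p.2.2⟩
  refine Nat.card_eq_of_bijective f ⟨?_, ?_⟩
  · rintro ⟨c, x, hx⟩ ⟨d, y, hy⟩ h
    have h' : c • x.rep = d • y.rep := congrArg Subtype.val h
    have hxy : x = y := by
      rw [← hmk c x, ← hmk d y]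
      congr 1
    subst hxy
    have hcd : c = d := Units.ext (smul_left_injective F x.rep_nonzero h')
    rw [hcd]
  · rintro ⟨v, hv, hS⟩
    obtain ⟨a, ha⟩ := Projectivization.exists_smul_eq_mk_rep F v hv
    refine ⟨(a⁻¹, ⟨_, hS⟩), Subtype.ext ?_⟩
    change a⁻¹ • (Projectivization.mk F v hv).rep = v
    rw [← ha, inv_smul_smul]

lemma pred_card_mul_ncard_quadricSection [Finite V] (Q : QuadraticForm F V) (U : Submodule F V) :
    (Nat.card F - 1) * (quadricSection Q U).ncard + 1 = (zeros Q U).ncard := by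
  have h0 : (0 : V) ∈ zeros Q U := ⟨U.zero_mem, Q.map_zero⟩
  rw [pred_card_mul_ncard, ← Set.ncard_sdiff_singleton_add_one h0 (Set.toFinite _)]
  congr 2
  ext v
  simp only [quadricSection, Set.mem_ofPred_eq, mk_mem_quadric, submodule_mk_le, zeros,
    Set.mem_sdiff, Set.mem_singleton_iff, exists_prop]
  tauto

lemma pred_card_mul_ncard_nonsingularPoints [Finite V] (Q : QuadraticForm F V)
    (U : Submodule F V) :
    (Nat.card F - 1) * (nonsingularPoints Q U).ncard + (zeros Q U).ncard = Nat.card U := by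
  rw [pred_card_mul_ncard, ← SetLike.coe_sort_coe, Nat.card_coe_set_eq,
    ← Set.ncard_union_eq _ (Set.toFinite _) (Set.toFinite _)]
  · congr 1
    ext v
    simp only [nonsingularPoints, Set.mem_ofPred_eq, mk_mem_quadric, submodule_mk_le, zeros,
      Set.mem_union, exists_prop, SetLike.mem_coe]
    have : v = 0 → Q v = 0 := fun h ↦ h ▸ Q.map_zero
    tauto
  · refine Set.disjoint_left.mpr fun v ⟨hv, hvQ, _⟩ hv' ↦ hvQ ?_
    exact (mk_mem_quadric hv).mpr hv'.2

section

variable [Finite F]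

/-- A binary quadratic form is anisotropic, the product of two independent linear forms, a multiple
of the square of a linear form, or zero; this leaves `q + 1`, `q - 1`, `q` or `0` points. -/
lemma ncard_nonsingularPoints_of_finrank_two [FiniteDimensional F V] (Q : QuadraticForm F V)
    {L : Submodule F V} (hL : Module.finrank F L = 2) :
    (nonsingularPoints Q L).ncard = 0 ∨ (nonsingularPoints Q L).ncard = Nat.card F - 1 ∨
      (nonsingularPoints Q L).ncard = Nat.card F ∨
      (nonsingularPoints Q L).ncard = Nat.card F + 1 := by
  have := Module.finite_of_finite F (M := V)
  have hcount := pred_card_mul_ncard_nonsingularPoints Q L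
  have hq : 1 < Nat.card F := Finite.one_lt_card
  obtain ⟨p, hp⟩ : ∃ p, Nat.card F = p + 1 := ⟨Nat.card F - 1, by lia⟩
  have hp0 : 0 < p := by lia
  rw [card_eq_pow, hL] at hcount
  by_cases hex : ∃ e ∈ L, e ≠ 0 ∧ Q e = 0
  · obtain ⟨e, heL, he0, hQe⟩ := hex
    have hT := isTotallySingular_span_singleton hQe
    have hTL : F ∙ e ≤ L := (Submodule.span_singleton_le_iff_mem _ _).mpr heL
    have hTP : F ∙ e ≤ L ⊓ perp Q (F ∙ e) := le_inf hTL hT.le_perp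
    by_cases hPL : L ⊓ perp Q (F ∙ e) = L
    · by_cases hall : ∀ v ∈ L, Q v = 0
      · rw [ncard_zeros_eq_card le_rfl hall fun v hv _ ↦ hv, card_eq_pow, hL] at hcount
        have h0 : (Nat.card F - 1) * (nonsingularPoints Q L).ncard = 0 := by lia
        exact Or.inl ((mul_eq_zero.mp h0).resolve_left (by lia))
      · have hz : ∀ v ∈ L, Q v = 0 → v ∈ F ∙ e := fun v hv hQv ↦ by
          by_contra hvT
          refine hall ?_
          have hlt := Submodule.finrank_lt_finrank_of_lt (lt_sup_span_singleton hvT)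
          rw [finrank_span_singleton he0] at hlt
          have hle : F ∙ e ⊔ F ∙ v ≤ L :=
            sup_le hTL ((Submodule.span_singleton_le_iff_mem _ _).mpr hv)
          rw [← Submodule.eq_of_le_of_finrank_le hle (by lia)]
          exact hT.sup_span_singleton (hPL.ge hv).2 hQv
        rw [ncard_zeros_eq_card hTL hT hz, card_eq_pow, finrank_span_singleton he0, hp,
          Nat.add_sub_cancel] at hcount
        refine Or.inr (Or.inr (Or.inl (Nat.eq_of_mul_eq_mul_left hp0 ?_)))
        rw [hp]
        linarith
    · have hlt := Submodule.finrank_lt_finrank_of_lt (lt_of_le_of_ne inf_le_left hPL)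
      have hPT : F ∙ e = L ⊓ perp Q (F ∙ e) := Submodule.eq_of_le_of_finrank_le hTP (by
        rw [finrank_span_singleton he0]; lia)
      have h := card_mul_ncard_zeros_add hTL hT
      rw [← hPT, ncard_zeros_eq_card le_rfl hT fun v hv _ ↦ hv, card_eq_pow, card_eq_pow, hL,
        finrank_span_singleton he0, hp] at h
      rw [hp, Nat.add_sub_cancel] at hcount ⊢
      refine Or.inr (Or.inl (Nat.eq_of_mul_eq_mul_left (mul_pos hp0 p.succ_pos) ?_))
      have := congrArg (fun z ↦ (p + 1) * z) hcount
      simp only [mul_add] at this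
      nlinarith
  · push Not at hex
    have hz : ∀ v ∈ L, Q v = 0 → v ∈ (⊥ : Submodule F V) := fun v hv hQv ↦ by
      by_contra h0
      exact hex v hv h0 hQv
    rw [ncard_zeros_eq_card bot_le
      (fun w hw ↦ by rw [(Submodule.mem_bot F).mp hw, Q.map_zero]) hz, card_eq_pow, finrank_bot,
      hp, Nat.add_sub_cancel] at hcount
    refine Or.inr (Or.inr (Or.inr (Nat.eq_of_mul_eq_mul_left hp0 ?_)))
    rw [hp]
    linarith

end

/-! ### Hyperplanes as orthogonal complements of points -/

lemma perp_perp [FiniteDimensional F V] {Q : QuadraticForm F V} (hB : Q.polarBilin.ker = ⊥)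
    (W : Submodule F V) : perp Q (perp Q W) = W :=
  LinearMap.BilinForm.orthogonal_orthogonal (polarBilin_nondegenerate hB) (polarBilin_isRefl Q) W

lemma finrank_perp [FiniteDimensional F V] {Q : QuadraticForm F V} (hB : Q.polarBilin.ker = ⊥)
    (W : Submodule F V) :
    Module.finrank F (perp Q W) = Module.finrank F V - Module.finrank F W :=
  LinearMap.BilinForm.finrank_orthogonal (polarBilin_nondegenerate hB) W

/-- A hyperplane `u^⊥` is parabolic if and only if its pole `u` is not on the quadric: the kernel of
the polar form restricted to `u^⊥` is contained in the span of `u`. -/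
lemma perp_mem_parabolicHyperplanes [FiniteDimensional F V] {Q : QuadraticForm F V} {n : ℕ}
    (hV : Module.finrank F V = 2 * n + 2) (hB : Q.polarBilin.ker = ⊥) {u : V} (hu0 : u ≠ 0) :
    perp Q (F ∙ u) ∈ parabolicHyperplanes n Q ↔ Q u ≠ 0 := by
  have hmem : ∀ v : perp Q (F ∙ u), v ∈ (Q.comp (perp Q (F ∙ u)).subtype).polarBilin.ker →
      (v : V) ∈ F ∙ u := fun v hv ↦ by
    refine (perp_perp hB (F ∙ u)).le (mem_perp.mpr fun w hw ↦ ?_)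
    rw [QuadraticMap.polar_comm]
    exact LinearMap.congr_fun hv ⟨w, hw⟩
  constructor
  · rintro ⟨-, hnd⟩ hQu
    have hu : u ∈ perp Q (F ∙ u) := by
      rw [mem_perp_span_singleton, QuadraticMap.polar_self, hQu, smul_zero]
    have hrad : (⟨u, hu⟩ : perp Q (F ∙ u)) ∈ (Q.comp (perp Q (F ∙ u)).subtype).radical :=
      ⟨hQu, LinearMap.ext fun w ↦ (mem_perp_span_singleton (Q := Q) (u := u)).mp w.2⟩
    rw [hnd.radical_eq_bot, Submodule.mem_bot] at hrad
    exact hu0 (congrArg Subtype.val hrad)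
  · intro hQu
    refine ⟨by rw [finrank_perp hB, hV, finrank_span_singleton hu0]; lia, ?_, ?_⟩
    · rw [eq_bot_iff]
      rintro v ⟨hv, hvB⟩
      obtain ⟨c, hc⟩ := Submodule.mem_span_singleton.mp (hmem v hvB)
      have hv' : Q (v : V) = 0 := hv
      rw [← hc, QuadraticMap.map_smul, smul_eq_mul] at hv'
      have hc0 : c = 0 := mul_self_eq_zero.mp ((mul_eq_zero.mp hv').resolve_right hQu)
      rw [Submodule.mem_bot]
      exact Subtype.ext (by rw [← hc, hc0, zero_smul, ZeroMemClass.coe_zero])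
    · rw [← Module.finrank_eq_rank, ← Submodule.finrank_map_subtype_eq]
      have hle : (Q.comp (perp Q (F ∙ u)).subtype).polarBilin.ker.map (perp Q (F ∙ u)).subtype ≤
          F ∙ u := by
        rintro _ ⟨v, hv, rfl⟩
        exact hmem v hv
      have := Submodule.finrank_mono hle
      rw [finrank_span_singleton hu0] at this
      exact_mod_cast this

lemma exists_eq_perp [FiniteDimensional F V] {Q : QuadraticForm F V} (hB : Q.polarBilin.ker = ⊥)
    {H : Submodule F V} (hH : Module.finrank F H + 1 = Module.finrank F V) :
    ∃ u ≠ 0, H = perp Q (F ∙ u) := by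
  have h1 : Module.finrank F (perp Q H) = 1 := by rw [finrank_perp hB]; lia
  refine ⟨(Projectivization.mk'' _ h1).rep, Projectivization.rep_nonzero _, ?_⟩
  rw [← Projectivization.submodule_eq, Projectivization.submodule_mk'', perp_perp hB]

lemma numContaining_parabolicHyperplanes [FiniteDimensional F V] {Q : QuadraticForm F V} {n : ℕ}
    (hV : Module.finrank F V = 2 * n + 2) (hB : Q.polarBilin.ker = ⊥) (W : Submodule F V) :
    numContaining (parabolicHyperplanes n Q) W = (nonsingularPoints Q (perp Q W)).ncard := by
  have hinj : Function.Injective fun x : ℙ F V ↦ perp Q x.submodule := fun x y h ↦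
    Projectivization.submodule_injective <| by
      rw [← perp_perp hB x.submodule, ← perp_perp hB y.submodule]
      exact congrArg (perp Q) h
  rw [numContaining, ← Set.ncard_image_of_injective _ hinj]
  congr 1
  ext H
  simp only [Set.mem_ofPred_eq, Set.mem_image]
  constructor
  · rintro ⟨hH, hWH⟩
    obtain ⟨u, hu0, rfl⟩ := exists_eq_perp hB (H := H) (by rw [hH.finrank_eq, hV])
    refine ⟨Projectivization.mk F u hu0, ⟨?_, ?_⟩, by rw [Projectivization.submodule_mk]⟩
    · rw [mk_mem_quadric]
      exact (perp_mem_parabolicHyperplanes hV hB hu0).mp hH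
    · rw [Projectivization.submodule_mk, ← perp_perp hB (F ∙ u)]
      exact LinearMap.BilinForm.orthogonal_le hWH
  · rintro ⟨x, ⟨hx, hxW⟩, rfl⟩
    induction x using Projectivization.ind with | _ u hu0
    rw [mk_mem_quadric] at hx
    refine ⟨?_, ?_⟩
    · rw [Projectivization.submodule_mk]
      exact (perp_mem_parabolicHyperplanes hV hB hu0).mpr hx
    · rw [← perp_perp hB W]
      exact LinearMap.BilinForm.orthogonal_le hxW

/-! ### The set of parabolic hyperplanes -/

section

variable [Finite F]

/-- The hypothesis `hN` on the number of singular vectors of `V` says that a tangent hyperplane does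
not have as many singular vectors as a parabolic one. -/
lemma parabolicHyperplanes_eq [FiniteDimensional F V] {Q : QuadraticForm F V} {n : ℕ}
    (hV : Module.finrank F V = 2 * n + 2) (hB : Q.polarBilin.ker = ⊥)
    (hN : (zeros Q ⊤).ncard ≠ Nat.card F ^ (2 * n + 1)) :
    parabolicHyperplanes n Q = hyperplanesWithParabolicCount n Q := by
  have := Module.finite_of_finite F (M := V)
  have hq : 1 < Nat.card F := Finite.one_lt_card
  -- The division defining the number of points is exact, so that it can be compared with the
  -- number of singular vectors.
  have hsec : ∀ H : Submodule F V,
      (quadricSection Q H).ncard = (Nat.card F ^ (2 * n) - 1) / (Nat.card F - 1) ↔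
        (zeros Q H).ncard = Nat.card F ^ (2 * n) := fun H ↦ by
    obtain ⟨d, hd⟩ := Nat.sub_one_dvd_pow_sub_one (Nat.card F) (2 * n)
    have hpos : 0 < Nat.card F ^ (2 * n) := pow_pos (by lia) _
    have hp : 0 < Nat.card F - 1 := by lia
    rw [← pred_card_mul_ncard_quadricSection, hd, Nat.mul_div_cancel_left d hp,
      show Nat.card F ^ (2 * n) = (Nat.card F - 1) * d + 1 by lia, Nat.add_right_cancel_iff,
      Nat.mul_right_inj hp.ne']
  ext H
  simp only [hyperplanesWithParabolicCount, Set.mem_ofPred_eq, hsec]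
  constructor
  · intro hH
    have hfr : Module.finrank F H + 1 = Module.finrank F V := by rw [hH.finrank_eq, hV]
    refine ⟨hfr, ?_⟩
    obtain ⟨u, hu0, rfl⟩ := exists_eq_perp hB hfr
    exact ncard_zeros_perp_of_ne_zero hV hB ((perp_mem_parabolicHyperplanes hV hB hu0).mp hH)
  · rintro ⟨hfr, hz⟩
    obtain ⟨u, hu0, rfl⟩ := exists_eq_perp hB hfr
    rw [perp_mem_parabolicHyperplanes hV hB hu0]
    intro hQu
    have h := ncard_zeros_perp_of_eq_zero hV hB hu0 hQu
    rw [hz, ← pow_succ', add_comm, Nat.add_right_cancel_iff, pow_succ' _ (2 * n + 1)] at h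
    exact hN (Nat.eq_of_mul_eq_mul_left Nat.card_pos h).symm

/-- The hypothesis `ha` says that `a` is the number of points off the quadric in a tangent
hyperplane, expressed through the number of singular vectors of `V` and cleared of denominators. -/
lemma condP1_parabolicHyperplanes [FiniteDimensional F V] {Q : QuadraticForm F V} {n a : ℕ}
    (hV : Module.finrank F V = 2 * n + 2) (hB : Q.polarBilin.ker = ⊥)
    (ha : (Nat.card F : ℤ) * (Nat.card F - 1) * a + Nat.card F * (zeros Q ⊤).ncard +
      Nat.card F ^ (2 * n + 1) = 2 * Nat.card F ^ (2 * n + 2)) :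
    CondP1 (parabolicHyperplanes n Q) a (Nat.card F ^ (2 * n)) := by
  have := Module.finite_of_finite F (M := V)
  have hq : 1 < Nat.card F := Finite.one_lt_card
  intro x
  rw [numContaining_parabolicHyperplanes hV hB]
  induction x using Projectivization.ind with | _ u hu0
  rw [Projectivization.submodule_mk]
  have hcount := pred_card_mul_ncard_nonsingularPoints Q (perp Q (F ∙ u))
  rw [card_eq_pow, finrank_perp hB, hV, finrank_span_singleton hu0,
    show 2 * n + 2 - 1 = 2 * n + 1 by lia] at hcount
  zify [hq.le] at hcount
  have hq0 : (Nat.card F : ℤ) - 1 ≠ 0 := by lia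
  have hq1 : (Nat.card F : ℤ) ≠ 0 := by lia
  by_cases hQu : Q u = 0
  · left
    have h := ncard_zeros_perp_of_eq_zero hV hB hu0 hQu
    zify at h ⊢
    refine mul_left_cancel₀ (mul_ne_zero hq1 hq0) ?_
    linear_combination (Nat.card F : ℤ) * hcount - h - ha
  · right
    rw [ncard_zeros_perp_of_ne_zero hV hB hQu] at hcount
    zify
    refine mul_left_cancel₀ hq0 ?_
    push_cast at hcount
    linear_combination hcount

lemma codimTwoNumbers_parabolicHyperplanes [FiniteDimensional F V] {Q : QuadraticForm F V} {n : ℕ}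
    (hV : Module.finrank F V = 2 * n + 2) (hB : Q.polarBilin.ker = ⊥) :
    CodimTwoNumbers (parabolicHyperplanes n Q) := fun W hW ↦ by
  rw [numContaining_parabolicHyperplanes hV hB]
  exact ncard_nonsingularPoints_of_finrank_two Q (by rw [finrank_perp hB]; lia)

lemma CodimTwoNumbers.condP2 [FiniteDimensional F V] {S : Set (Submodule F V)}
    (h : CodimTwoNumbers S) : CondP2 S := by
  have := Module.finite_of_finite F (M := V)
  rintro W hW ⟨H, hHS, hWH⟩
  have hpos : 0 < numContaining S W :=
    (Set.ncard_pos (Set.toFinite _)).mpr ⟨H, hHS, hWH⟩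
  rcases h W hW with h | h | h | h <;> lia

end

end PGQuadric

theorem proposition2p1 {F V : Type*} [Field F] [Finite F] [AddCommGroup V] [Module F V]
    (n : ℕ) (Q : QuadraticForm F V) :
    (PGQuadric.IsHyperbolic n Q →
      PGQuadric.parabolicHyperplanes n Q = PGQuadric.hyperplanesWithParabolicCount n Q ∧
      PGQuadric.CondP1 (PGQuadric.parabolicHyperplanes n Q)
        (Nat.card F ^ n * (Nat.card F ^ n - 1)) (Nat.card F ^ (2 * n)) ∧
      PGQuadric.CondP2 (PGQuadric.parabolicHyperplanes n Q) ∧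
      PGQuadric.CodimTwoNumbers (PGQuadric.parabolicHyperplanes n Q)) ∧
    (PGQuadric.IsElliptic n Q →
      PGQuadric.parabolicHyperplanes n Q = PGQuadric.hyperplanesWithParabolicCount n Q ∧
      PGQuadric.CondP1 (PGQuadric.parabolicHyperplanes n Q)
        (Nat.card F ^ n * (Nat.card F ^ n + 1)) (Nat.card F ^ (2 * n)) ∧
      PGQuadric.CondP2 (PGQuadric.parabolicHyperplanes n Q) ∧
      PGQuadric.CodimTwoNumbers (PGQuadric.parabolicHyperplanes n Q)) := by
  have hq : 1 < Nat.card F := Finite.one_lt_card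
  constructor
  · rintro ⟨hV, hnd, hW⟩
    have : FiniteDimensional F V := Module.finite_of_finrank_pos (by lia)
    have hB := PGQuadric.ker_polarBilin_eq_bot hV hnd hW
    have hN := PGQuadric.card_mul_ncard_zeros_top (m := n + 1) (by lia) hnd hW
    have hlt : Nat.card F ^ (n + 1) < Nat.card F ^ (n + 1 + 1) := Nat.pow_lt_pow_right hq (by lia)
    have hpos : 1 ≤ Nat.card F ^ n := Nat.one_le_pow _ _ (by lia)
    have hcodim := PGQuadric.codimTwoNumbers_parabolicHyperplanes hV hB
    refine ⟨PGQuadric.parabolicHyperplanes_eq hV hB fun h ↦ ?_,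
      PGQuadric.condP1_parabolicHyperplanes hV hB ?_, hcodim.condP2, hcodim⟩
    · rw [h, ← pow_succ', show 2 * n + 1 + 1 = n + 1 + (n + 1) by lia] at hN
      lia
    · zify [hpos] at hN ⊢
      linear_combination hN
  · rintro ⟨hV, hnd, hW⟩
    have : FiniteDimensional F V := Module.finite_of_finrank_pos (by lia)
    have hB := PGQuadric.ker_polarBilin_eq_bot hV hnd hW
    have hN := PGQuadric.card_mul_ncard_zeros_top (m := n + 2) (by lia) hnd hW
    have hlt : Nat.card F ^ (n + 1) < Nat.card F ^ (n + 2) := Nat.pow_lt_pow_right hq (by lia)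
    have hcodim := PGQuadric.codimTwoNumbers_parabolicHyperplanes hV hB
    refine ⟨PGQuadric.parabolicHyperplanes_eq hV hB fun h ↦ ?_,
      PGQuadric.condP1_parabolicHyperplanes hV hB ?_, hcodim.condP2, hcodim⟩
    · rw [h, ← pow_succ', show 2 * n + 1 + 1 = n + (n + 2) by lia] at hN
      lia
    · zify at hN ⊢
      linear_combination hN
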